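/- Let $q,r,b,c$ be real numbers with $q\neq 0$ and $c\neq 0$. Let $(P_j)_{j\in\mathbb Z}$ and $(U_j)_{j\in\mathbb Z}$ be the sequences of polynomials in $\mathbb R[x]$ given by \[P_0=1,\quad P_1=qx+r,\quad P_{j+2}=(x+b)P_{j+1}+cP_j,\qquad U_0=0,\quad U_1=1,\quad U_{j+2}=(x+b)U_{j+1}+cU_j,\] where the recurrences hold for all $j\in\mathbb Z$ (for negative indices they are solved backwards, which is possible since $c\ne 0$). Put \[\Delta=(q^2-q)x^2+(2qr-r-bq)x+(r^2-br-c).\] For $t\ge 0$ write $P_j^{\langle t\rangle}=P_jP_{j+1}\cdots P_{j+t-1}$ (so $P_j^{\langle 0\rangle}=1$). Let $n\ge 0$, $m\ge 1$, $d\ge 1$ be integers, let $s,k$ be any integers, and let $(d_i)_{1\le i\le m}$, $(e_i)_{1\le i\le m}$ be any sequences of integers. Then the following hold. (1) In $\mathbb R[x]$, \[\det\big([P_{n+i+j}^m]_{0\le i,j\le m}\big)=(-1)^{(n+1)\binom{m+1}{2}}\,\Delta^{\binom{m+1}{2}}\,c^{\,n\binom{m+1}{2}+2\binom{m+1}{3}}\prod_{i=0}^m\Big(\binom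 mi U_{i+1}^{2(m-i)}\Big).\] (2) In $\mathbb R[x]$, \[\det\Big(\Big[\prod_{f=j+1}^m P_{n+i+d_f}\prod_{g=1}^jP_{n+i+e_g}\Big]_{0\le i,j\le m}\Big)=(-\Delta)^{\binom{m+1}{2}}(-c)^{n\binom{m+1}{2}+\binom{m+1}{3}}\prod_{l=1}^mU_l^{m+1-l}\prod_{1\le i\le j\le m}(-c)^{d_j}U_{e_i-d_j}.\] (3) If $P_{s+k(n+i+j)}$ is not the zero polynomial for those $0\le i,j\le m$ with $s+k(n+i+j)<0$ (for nonnegative indices this is automatic), then in $\mathbb R(x)$ \[\det\Big(\Big[\frac1{P_{s+k(n+i+j)}}\Big]_{0\le i,j\le m}\Big)=\frac{(-1)^{(s+kn)\binom{m+1}{2}}\,c^{(s+kn)\binom{m+1}{2}+2k\binom{m+1}{3}}\,\Delta^{\binom{m+1}{2}}\prod_{i=0}^mU_{k(i+1)}^{2(m-i)}}{\prod_{0\le i,j\le m}P_{s+k(n+i+j)}}.\] (4) In $\mathbb R[x]$, \[\det\big([P_{n+i+j}^{\langle m\rangle}]_{0\le i,j\le d-1}\big)=(-1)^{n\binom d2+\binom{d+1}{3}}\,c^{(n+d-2)\binom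 d2}\,\Delta^{\binom d2}\prod_{i=1}^{d-1}\big(U_iU_{m+1-i}\big)^{d-i}\prod_{i=d-1}^{2(d-1)}P_{n+i}^{\langle m+1-d\rangle},\] where for $d>m+1$ the last product is read as $1$ (both sides are then $0$, since $U_0=0$ occurs as a factor). -/

import Mathlib

open Polynomial

noncomputable section

/-- The terms of index `n ≥ 0` of the sequence of polynomials `𝒫(x)(p, q, r; a, b, c)`. -/
def polySeqNonneg (p q r a b c : ℝ) : ℕ → ℝ[X]
  | 0 => C p
  | 1 => C q * X + C r
  | n + 2 => (C a * X + C b) * polySeqNonneg p q r a b c (n + 1) + C c * polySeqNonneg p q r a b c n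

/-- `polySeqNonpos p q r a b c n` is the term of index `-n` of `𝒫(x)(p, q, r; a, b, c)`, obtained
by running the recurrence backwards:
`P_k = -((a x + b) / c) P_{k+1} + (1 / c) P_{k+2}` for `k < 0`. -/
def polySeqNonpos (p q r a b c : ℝ) : ℕ → ℝ[X]
  | 0 => C p
  | 1 => -(C (1 / c) * (C a * X + C b)) * C p + C (1 / c) * (C q * X + C r)
  | n + 2 => -(C (1 / c) * (C a * X + C b)) * polySeqNonpos p q r a b c (n + 1)
      + C (1 / c) * polySeqNonpos p q r a b c n

/-- The sequence of polynomials `𝒫(x)(p, q, r; a, b, c) = (P_n)_{n ∈ ℤ}` with `P_0 = p`,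
`P_1 = q x + r`, `P_{n+2} = (a x + b) P_{n+1} + c P_n`, extended to negative indices by the same
recurrence (for `c ≠ 0`). -/
def polySeq (p q r a b c : ℝ) : ℤ → ℝ[X]
  | Int.ofNat n => polySeqNonneg p q r a b c n
  | Int.negSucc n => polySeqNonpos p q r a b c (n + 1)

/-- The rising power `P_n^⟨m⟩ = P_n P_{n+1} ⋯ P_{n+m-1}` (so `P_n^⟨0⟩ = 1`). -/
def risingPow (P : ℤ → ℝ[X]) (n : ℤ) (m : ℕ) : ℝ[X] :=
  ∏ t ∈ Finset.range m, P (n + t)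

end

theorem polySeq_zero (p q r a b c : ℝ) : polySeq p q r a b c 0 = C p := rfl

theorem polySeq_one (p q r a b c : ℝ) : polySeq p q r a b c 1 = C q * X + C r := rfl

/-- For `c ≠ 0` the recurrence holds at every integer index. -/
theorem polySeq_add_two (p q r a b c : ℝ) (hc : c ≠ 0) (n : ℤ) :
    polySeq p q r a b c (n + 2) =
      (C a * X + C b) * polySeq p q r a b c (n + 1) + C c * polySeq p q r a b c n := by
  have hcc : (C c : ℝ[X]) * C (1 / c) = 1 := by
    rw [← C_mul, mul_one_div_cancel hc, C_1]
  match n with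
  | Int.ofNat k => rfl
  | Int.negSucc 0 =>
    change (C q * X + C r : ℝ[X]) = (C a * X + C b) * C p +
      C c * (-(C (1 / c) * (C a * X + C b)) * C p + C (1 / c) * (C q * X + C r))
    linear_combination ((C a * X + C b) * C p - (C q * X + C r)) * hcc
  | Int.negSucc 1 =>
    change (C p : ℝ[X]) = (C a * X + C b) * polySeqNonpos p q r a b c 1 +
      C c * (-(C (1 / c) * (C a * X + C b)) * polySeqNonpos p q r a b c 1 + C (1 / c) * C p)
    linear_combination ((C a * X + C b) * polySeqNonpos p q r a b c 1 - C p) * hcc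
  | Int.negSucc (k + 2) =>
    change polySeqNonpos p q r a b c (k + 1) =
      (C a * X + C b) * polySeqNonpos p q r a b c (k + 2) +
      C c * (-(C (1 / c) * (C a * X + C b)) * polySeqNonpos p q r a b c (k + 2)
        + C (1 / c) * polySeqNonpos p q r a b c (k + 1))
    linear_combination ((C a * X + C b) * polySeqNonpos p q r a b c (k + 2)
      - polySeqNonpos p q r a b c (k + 1)) * hcc

/-! ### Determinants of products of linear forms evaluated at points -/

section Determinants

variable {R : Type*} [CommRing R]

/-! Every solution W of the recurrence satisfies W(N+t) = U(t) W(N+1) + c U(t-1) W(N)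
(`recurrence_shift`). Hence W(N+t) is the linear form with coefficients (U(t), c U(t-1)) evaluated
at the point (W(N+1), W(N)), with one point per matrix row. All four determinants reduce to one
identity, `det_prod_linear_forms`, whose value is a product of 2×2 brackets, of pairs of points and
of pairs of forms. Powers follow from its Vandermonde case and the binomial theorem, reciprocals by
clearing denominators row by row, rising powers by taking the forms at consecutive indices.

The brackets are evaluated by `recurrence_vajda`: the points at N and N+e have bracket (-c)^N Δ
U(e), where Δ = W(1)^2 - W(0) W(2). Brackets of forms are the case W = U, whose invariant is 1. What
remains is to count exponents over pairs a < k. -/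

theorem mul_prod_Ico_range_cross (α β γ δ : ℕ → R) (m j : ℕ) (hj : j ≤ m) (y z y' z' : R) :
    (γ j * y' + δ j * z') * ((∏ f ∈ Finset.Ico j (m + 1), (α f * y + β f * z)) *
        ∏ g ∈ Finset.range j, (γ g * y + δ g * z)) -
      (α j * y' + β j * z') * ((∏ f ∈ Finset.Ico (j + 1) (m + 1), (α f * y + β f * z)) *
        ∏ g ∈ Finset.range (j + 1), (γ g * y + δ g * z)) =
    (y * z' - y' * z) * ((α j * δ j - β j * γ j) *
      ((∏ f ∈ Finset.Ico j m, (α (f + 1) * y + β (f + 1) * z)) *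
        ∏ g ∈ Finset.range j, (γ g * y + δ g * z))) := by
  rw [Finset.prod_eq_prod_Ico_succ_bot (Nat.lt_succ_of_le hj), Finset.prod_range_succ,
    ← Finset.prod_Ico_add' (fun f => α f * y + β f * z) j m 1]
  ring

/-- The determinant of products of linear forms evaluated at points, when half of the forms take
regular values. -/
theorem det_prod_linear_forms_of_regular (m : ℕ) (y z α β γ δ : ℕ → R)
    (h : ∀ g i, γ g * y i + δ g * z i ∈ nonZeroDivisors R) :
    Matrix.det (Matrix.of fun i j : Fin (m + 1) =>
      (∏ f ∈ Finset.Ico (j : ℕ) m, (α f * y i + β f * z i)) *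
        ∏ g ∈ Finset.range (j : ℕ), (γ g * y i + δ g * z i)) =
    (∏ k ∈ Finset.range (m + 1), ∏ a ∈ Finset.range k, (y a * z k - y k * z a)) *
      ∏ j ∈ Finset.range m, ∏ i ∈ Finset.range (j + 1), (α j * δ i - β j * γ i) := by
  induction m generalizing α β with
  | zero => simp
  | succ m ih =>
    set M : Matrix (Fin (m + 2)) (Fin (m + 2)) R := Matrix.of fun i j =>
      (∏ f ∈ Finset.Ico (j : ℕ) (m + 1), (α f * y i + β f * z i)) *
        ∏ g ∈ Finset.range (j : ℕ), (γ g * y i + δ g * z i) with hM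
    -- Let p be the last point. Right multiplication by B replaces column j by γδ_j(p)·(column j) -
    -- αβ_j(p)·(column j+1) and keeps the last column. The new column carries the bracket of row i's
    -- point with p, so the last row vanishes outside its last entry.
    let B : Matrix (Fin (m + 2)) (Fin (m + 2)) R := Matrix.of fun r j =>
      Fin.lastCases (motive := fun _ => R) (if r = Fin.last _ then 1 else 0)
        (fun j => (if r = j.castSucc then γ j * y (m + 1) + δ j * z (m + 1) else 0) +
          (if r = j.succ then -(α j * y (m + 1) + β j * z (m + 1)) else 0)) j
    have hB : B.det = ∏ g ∈ Finset.range (m + 1), (γ g * y (m + 1) + δ g * z (m + 1)) := by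
      rw [Matrix.det_of_isLowerTriangular, Fin.prod_univ_castSucc]
      · simp [B, Finset.prod_range, Fin.castSucc_ne_last, (Fin.castSucc_lt_succ).ne]
      · intro r j hrj
        have hrj : r < j := hrj
        induction j using Fin.lastCases with
        | last => simp [B, hrj.ne]
        | cast j =>
          have h2 : r ≠ j.succ := (hrj.trans (Fin.castSucc_lt_succ)).ne
          simp [B, hrj.ne, h2]
    have hlast : ∀ i, (M * B) i (Fin.last _) = M i (Fin.last _) := by
      intro i
      simp [Matrix.mul_apply, B]
    have hcast : ∀ i (j : Fin (m + 1)), (M * B) i j.castSucc =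
        (y i * z (m + 1) - y (m + 1) * z i) * ((α j * δ j - β j * γ j) *
          ((∏ f ∈ Finset.Ico (j : ℕ) m, (α (f + 1) * y i + β (f + 1) * z i)) *
            ∏ g ∈ Finset.range (j : ℕ), (γ g * y i + δ g * z i))) := by
      intro i j
      rw [← mul_prod_Ico_range_cross α β γ δ m j (Nat.lt_succ_iff.mp j.2) (y i) (z i)]
      simp only [Matrix.mul_apply, B, Matrix.of_apply, Fin.lastCases_castSucc, mul_add, mul_ite,
        mul_zero, Finset.sum_add_distrib, Finset.sum_ite_eq', Finset.mem_univ,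
        if_true, hM, Fin.val_castSucc, Fin.val_succ]
      ring
    have hsub : ((M * B).submatrix Fin.castSucc Fin.castSucc).det =
        (∏ a ∈ Finset.range (m + 1), (y a * z (m + 1) - y (m + 1) * z a)) *
          ((∏ j ∈ Finset.range (m + 1), (α j * δ j - β j * γ j)) *
            Matrix.det (Matrix.of fun i j : Fin (m + 1) =>
              (∏ f ∈ Finset.Ico (j : ℕ) m, (α (f + 1) * y i + β (f + 1) * z i)) *
                ∏ g ∈ Finset.range (j : ℕ), (γ g * y i + δ g * z i))) := by
      rw [Finset.prod_range, Finset.prod_range, ← Matrix.det_mul_row, ← Matrix.det_mul_column]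
      congr 1
      ext i j
      rw [Matrix.submatrix_apply, hcast]
      rfl
    have hdet : (M * B).det =
        (∏ g ∈ Finset.range (m + 1), (γ g * y (m + 1) + δ g * z (m + 1))) *
          ((M * B).submatrix Fin.castSucc Fin.castSucc).det := by
      rw [Matrix.det_succ_row _ (Fin.last _), Fin.sum_univ_castSucc, Finset.sum_eq_zero]
      · rw [hlast, Fin.succAbove_last, zero_add, Even.neg_one_pow ⟨_, rfl⟩, one_mul]
        congr 1
        simp [hM]
      · intro j _
        rw [hcast]
        simp
    -- This product is both det B and the last diagonal entry of M; being regular, it cancels. The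
    -- remaining minor is the same kind of matrix with the α, β forms shifted by one.
    have hreg : (∏ g ∈ Finset.range (m + 1), (γ g * y (m + 1) + δ g * z (m + 1))) ∈
        nonZeroDivisors R := prod_mem fun g _ => h g (m + 1)
    rw [Matrix.det_mul, hB, hsub, ih (fun f => α (f + 1)) (fun f => β (f + 1)), mul_comm] at hdet
    rw [mul_cancel_left_mem_nonZeroDivisors hreg] at hdet
    rw [hdet, Finset.prod_range_succ _ (m + 1)]
    -- The diagonal factors i = j come from this elimination; the factors i < j, after j is shifted,
    -- come from the induction hypothesis.
    have hsplit : ∏ j ∈ Finset.range (m + 1), ∏ i ∈ Finset.range (j + 1),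
        (α j * δ i - β j * γ i) = (∏ j ∈ Finset.range (m + 1), (α j * δ j - β j * γ j)) *
        ∏ j ∈ Finset.range m, ∏ i ∈ Finset.range (j + 1),
          (α (j + 1) * δ i - β (j + 1) * γ i) := by
      have hj : ∀ j, ∏ i ∈ Finset.range (j + 1), (α j * δ i - β j * γ i) =
          (∏ i ∈ Finset.range j, (α j * δ i - β j * γ i)) * (α j * δ j - β j * γ j) :=
        fun j => Finset.prod_range_succ _ _
      rw [Finset.prod_congr rfl fun j _ => hj j, Finset.prod_mul_distrib, mul_comm,
        Finset.prod_range_succ' (fun j => ∏ i ∈ Finset.range j, (α j * δ i - β j * γ i)) m]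
      simp
    rw [hsplit]
    ring

/-- A homogeneous form of Krattenthaler's determinant lemma. -/
theorem det_prod_linear_forms (m : ℕ) (y z α β γ δ : ℕ → R) :
    Matrix.det (Matrix.of fun i j : Fin (m + 1) =>
      (∏ f ∈ Finset.Ico (j : ℕ) m, (α f * y i + β f * z i)) *
        ∏ g ∈ Finset.range (j : ℕ), (γ g * y i + δ g * z i)) =
    (∏ k ∈ Finset.range (m + 1), ∏ a ∈ Finset.range k, (y a * z k - y k * z a)) *
      ∏ j ∈ Finset.range m, ∏ i ∈ Finset.range (j + 1), (α j * δ i - β j * γ i) := by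
  nontriviality R
  -- Regularity is forced by deformation: adding X to each y and γ makes every form value a monic
  -- quadratic over R, and X = 0 recovers the original identity.
  have key := congrArg (evalRingHom (0 : R)) (det_prod_linear_forms_of_regular m
    (fun i => X + C (y i)) (fun i => C (z i)) (fun i => C (α i)) (fun i => C (β i))
    (fun i => X + C (γ i)) (fun i => C (δ i)) fun g i => by
      apply Monic.mem_nonZeroDivisors
      rw [← C_mul]
      refine ((monic_X_add_C _).mul (monic_X_add_C _)).add_of_left ?_
      refine degree_C_le.trans_lt ?_
      rw [(monic_X_add_C _).degree_mul, degree_X_add_C, degree_X_add_C]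
      decide)
  rw [RingHom.map_det] at key
  simpa [Matrix.map, RingHom.mapMatrix_apply, map_prod, eval_prod] using key

theorem det_homogeneous_vandermonde (m : ℕ) (y z : ℕ → R) :
    Matrix.det (Matrix.of fun i j : Fin (m + 1) => y i ^ (m - (j : ℕ)) * z i ^ (j : ℕ)) =
    ∏ k ∈ Finset.range (m + 1), ∏ a ∈ Finset.range k, (y a * z k - y k * z a) := by
  simpa using det_prod_linear_forms m y z (fun _ => 1) (fun _ => 0) (fun _ => 0) (fun _ => 1)

/-- By the binomial theorem the matrix is (Vandermonde in y, z) · diag(binomials) · (Vandermonde in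
v, w)ᵀ. -/
theorem det_linear_form_pow (m : ℕ) (y z v w : ℕ → R) :
    Matrix.det (Matrix.of fun i j : Fin (m + 1) => (v j * y i + w j * z i) ^ m) =
    (∏ k ∈ Finset.range (m + 1), ∏ a ∈ Finset.range k, (y a * z k - y k * z a)) *
      (∏ t ∈ Finset.range (m + 1), (m.choose t : R)) *
      ∏ k ∈ Finset.range (m + 1), ∏ a ∈ Finset.range k, (v a * w k - v k * w a) := by
  rw [← det_homogeneous_vandermonde, ← det_homogeneous_vandermonde, Finset.prod_range,
    ← Matrix.det_diagonal, ← Matrix.det_mul, ← Matrix.det_transpose (Matrix.of fun i j : Fin (m + 1) =>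
      v i ^ (m - (j : ℕ)) * w i ^ (j : ℕ)), ← Matrix.det_mul]
  congr 1
  ext i j
  rw [Matrix.mul_apply, Matrix.of_apply, add_comm, add_pow, Finset.sum_range]
  refine Finset.sum_congr rfl fun t _ => ?_
  simp only [Matrix.mul_diagonal, Matrix.of_apply, Matrix.transpose_apply]
  ring

theorem prod_Ico_mul_prod_range_eq_prod_erase (m : ℕ) (j : Fin (m + 1)) (g : ℕ → R) :
    (∏ f ∈ Finset.Ico (j : ℕ) m, g (f + 1)) * ∏ f ∈ Finset.range (j : ℕ), g f =
      ∏ f ∈ Finset.univ.erase j, g (f : Fin (m + 1)) := by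
  have h : (Finset.range (m + 1)).erase j = (Finset.univ.erase j).map Fin.valEmbedding := by
    ext x
    simp only [Finset.mem_erase, Finset.mem_range, Finset.mem_map, Finset.mem_univ, and_true,
      Fin.valEmbedding_apply]
    constructor
    · rintro ⟨h1, h2⟩
      exact ⟨⟨x, h2⟩, fun h => h1 (by simp [← h]), rfl⟩
    · rintro ⟨a, ha, rfl⟩
      exact ⟨fun h => ha (Fin.ext h), a.2⟩
  have h' : (Finset.range (m + 1)).erase j =
      (Finset.range (j : ℕ)).disjUnion (Finset.Ico ((j : ℕ) + 1) (m + 1)) (by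
        rw [Finset.disjoint_left]; intro a; simp; omega) := by
    ext x
    have := j.2
    simp only [Finset.mem_erase, Finset.mem_range, Finset.mem_disjUnion, Finset.mem_Ico]
    omega
  have hmap := Finset.prod_map (Finset.univ.erase j) Fin.valEmbedding g
  simp only [Fin.valEmbedding_apply] at hmap
  rw [← hmap, ← h, h',
    Finset.prod_disjUnion, Finset.prod_Ico_add' g _ m 1, mul_comm]

/-- A homogeneous form of Cauchy's double alternant. -/
theorem det_inv_linear_form {F : Type*} [Field F] (φ : R →+* F) (m : ℕ) (y z v w : ℕ → R)
    (h : ∀ i j : Fin (m + 1), φ (v j * y i + w j * z i) ≠ 0) :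
    Matrix.det (Matrix.of fun i j : Fin (m + 1) => 1 / φ (v j * y i + w j * z i)) =
    φ ((∏ k ∈ Finset.range (m + 1), ∏ a ∈ Finset.range k, (y a * z k - y k * z a)) *
      ∏ j ∈ Finset.range m, ∏ i ∈ Finset.range (j + 1), (v (j + 1) * w i - w (j + 1) * v i)) /
    φ (∏ i : Fin (m + 1), ∏ j : Fin (m + 1), (v j * y i + w j * z i)) := by
  have h0 : φ (∏ i : Fin (m + 1), ∏ j : Fin (m + 1), (v j * y i + w j * z i)) ≠ 0 := by
    simp only [map_prod]
    exact Finset.prod_ne_zero_iff.mpr fun i _ => Finset.prod_ne_zero_iff.mpr fun j _ => h i j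
  -- Scaling row i by the product of its denominators leaves, in column j, the product of all forms
  -- but the j-th: forms 0..j-1 play γ, δ and forms j+1..m play α, β.
  rw [eq_div_iff h0, ← det_prod_linear_forms m y z (fun j => v (j + 1)) (fun j => w (j + 1)) v w,
    mul_comm, map_prod, ← Matrix.det_mul_column, RingHom.map_det]
  congr 1
  ext i j
  simp only [Matrix.of_apply, RingHom.mapMatrix_apply, Matrix.map_apply]
  rw [prod_Ico_mul_prod_range_eq_prod_erase m j (fun f => v f * y i + w f * z i),
    ← Finset.mul_prod_erase _ _ (Finset.mem_univ j), map_mul,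
    mul_one_div, mul_div_cancel_left₀ _ (h i j)]

end Determinants

/-! ### Addition, Cassini and Vajda identities for the recurrence -/

section Recurrence

variable {b c : ℝ}

theorem eq_zero_of_recurrence (hc : c ≠ 0) {W : ℤ → ℝ[X]}
    (hW : ∀ n, W (n + 2) = (X + C b) * W (n + 1) + C c * W n) (h0 : W 0 = 0) (h1 : W 1 = 0)
    (n : ℤ) : W n = 0 := by
  have hC : (C c : ℝ[X]) ≠ 0 := C_ne_zero.mpr hc
  suffices h : W n = 0 ∧ W (n + 1) = 0 from h.1
  induction n using Int.induction_on with
  | zero => exact ⟨h0, h1⟩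
  | succ k ih =>
    refine ⟨ih.2, ?_⟩
    rw [add_assoc, show (1 + 1 : ℤ) = 2 from rfl, hW, ih.1, ih.2]
    simp
  | pred k ih =>
    rw [show (-(k : ℤ) - 1 + 1) = -k by ring]
    refine ⟨?_, ih.1⟩
    have := hW (-(k : ℤ) - 1)
    rw [show (-(k : ℤ) - 1 + 2) = -k + 1 by ring, show (-(k : ℤ) - 1 + 1) = -k by ring, ih.1,
      ih.2] at this
    simpa [hC] using this

variable {U W : ℤ → ℝ[X]}

/-- As functions of t both sides solve the recurrence, and they agree at t = 0 (where c U(-1) = 1)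
and t = 1. -/
theorem recurrence_shift (hc : c ≠ 0)
    (hU : ∀ n, U (n + 2) = (X + C b) * U (n + 1) + C c * U n) (hU0 : U 0 = 0) (hU1 : U 1 = 1)
    (hW : ∀ n, W (n + 2) = (X + C b) * W (n + 1) + C c * W n) (N t : ℤ) :
    W (N + t) = U t * W (N + 1) + C c * U (t - 1) * W N := by
  have hm : C c * U (-1) = 1 := by
    have := hU (-1)
    norm_num [hU0, hU1] at this
    exact this.symm
  rw [← sub_eq_zero]
  refine eq_zero_of_recurrence (b := b) hc
    (W := fun t => W (N + t) - (U t * W (N + 1) + C c * U (t - 1) * W N)) ?_ ?_ ?_ t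
  · intro n
    have h1 := hW (N + n)
    have h2 := hU n
    have h3 := hU (n - 1)
    rw [show n - 1 + 2 = n + 2 - 1 by ring, show n - 1 + 1 = n + 1 - 1 by ring] at h3
    rw [add_assoc, add_assoc] at h1
    linear_combination h1 - W (N + 1) * h2 - C c * W N * h3
  · simp only [zero_sub, add_zero, hU0]
    linear_combination -W N * hm
  · simp [hU0, hU1]

/-- The left side is multiplied by -c when N grows by one; since c ≠ 0 this also runs downwards. -/
theorem recurrence_cassini (hc : c ≠ 0)
    (hW : ∀ n, W (n + 2) = (X + C b) * W (n + 1) + C c * W n) (N : ℤ) :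
    W (N + 1) ^ 2 - W N * W (N + 2) = C ((-c) ^ N) * (W 1 ^ 2 - W 0 * W 2) := by
  have hC : (C c : ℝ[X]) ≠ 0 := C_ne_zero.mpr hc
  have hc' : -c ≠ 0 := neg_ne_zero.mpr hc
  have step : ∀ N, W (N + 1 + 1) ^ 2 - W (N + 1) * W (N + 1 + 2) =
      -C c * (W (N + 1) ^ 2 - W N * W (N + 2)) := by
    intro N
    have h1 := hW N
    have h2 := hW (N + 1)
    rw [add_assoc N 1 1, show (1 + 1 : ℤ) = 2 from rfl] at *
    rw [h2]
    linear_combination W (N + 2) * h1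
  induction N using Int.induction_on with
  | zero => simp
  | succ k ih =>
    rw [step, ih, zpow_add_one₀ hc', C_mul, C_neg]
    ring
  | pred k ih =>
    have := step (-(k : ℤ) - 1)
    rw [sub_add_cancel, ih, show (-(k : ℤ)) = (-(k : ℤ) - 1) + 1 by ring, zpow_add_one₀ hc', C_mul,
      C_neg] at this
    rw [sub_add_cancel] at *
    apply mul_left_cancel₀ hC
    linear_combination this

theorem recurrence_vajda (hc : c ≠ 0)
    (hU : ∀ n, U (n + 2) = (X + C b) * U (n + 1) + C c * U n) (hU0 : U 0 = 0) (hU1 : U 1 = 1)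
    (hW : ∀ n, W (n + 2) = (X + C b) * W (n + 1) + C c * W n) (N e : ℤ) :
    W (N + 1) * W (N + e) - W N * W (N + e + 1) =
      C ((-c) ^ N) * (W 1 ^ 2 - W 0 * W 2) * U e := by
  rw [← recurrence_cassini hc hW, recurrence_shift hc hU hU0 hU1 hW N e,
    show N + e + 1 = N + 1 + e by ring, recurrence_shift hc hU hU0 hU1 hW (N + 1) e,
    add_assoc N 1 1, show (1 + 1 : ℤ) = 2 from rfl]
  ring

/-- This is Vajda for U itself, based at s - 1, where the invariant U(1)^2 - U(0) U(2) equals 1. -/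
theorem recurrence_coeff_bracket (hc : c ≠ 0)
    (hU : ∀ n, U (n + 2) = (X + C b) * U (n + 1) + C c * U n) (hU0 : U 0 = 0) (hU1 : U 1 = 1)
    (s t : ℤ) :
    U s * (C c * U (t - 1)) - C c * U (s - 1) * U t = -(C ((-c) ^ s) * U (t - s)) := by
  have h := recurrence_vajda hc hU hU0 hU1 hU (s - 1) (t - s)
  have h2 : U 2 = X + C b := by simpa [hU0, hU1] using hU 0
  rw [sub_add_cancel, show s - 1 + (t - s) = t - 1 by ring, sub_add_cancel, hU0, hU1] at h
  have hz : C ((-c) ^ s) = -(C c * C ((-c) ^ (s - 1))) := by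
    rw [← C_mul, ← C_neg]
    congr 1
    rw [zpow_sub_one₀ (neg_ne_zero.mpr hc)]
    field_simp
  rw [hz]
  linear_combination C c * h

/-- The summand c P(n) has degree two below the leading one, so no cancellation occurs. This gives
nonvanishing at nonnegative indices. -/
theorem polySeqNonneg_degree {q c : ℝ} (hq : q ≠ 0) (hc : c ≠ 0) (r b : ℝ) (n : ℕ) :
    (polySeqNonneg 1 q r 1 b c n).degree = n := by
  suffices h : (polySeqNonneg 1 q r 1 b c n).degree = n ∧
      (polySeqNonneg 1 q r 1 b c (n + 1)).degree = (n + 1 : ℕ) from h.1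
  induction n with
  | zero =>
    constructor
    · simp [polySeqNonneg]
    · simpa [polySeqNonneg] using degree_linear hq
  | succ n ih =>
    refine ⟨ih.2, ?_⟩
    have h1 : ((C 1 * X + C b) * polySeqNonneg 1 q r 1 b c (n + 1)).degree = ((n + 2 : ℕ) : WithBot ℕ) := by
      rw [degree_mul, degree_linear one_ne_zero, ih.2]
      push_cast
      ring
    change ((C 1 * X + C b) * polySeqNonneg 1 q r 1 b c (n + 1) +
      C c * polySeqNonneg 1 q r 1 b c n).degree = _
    rw [degree_add_eq_left_of_degree_lt, h1]
    rw [h1]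
    rw [degree_C_mul hc, ih.1]
    exact_mod_cast (by omega : n < n + 2)

theorem polySeq_ne_zero {q c : ℝ} (hq : q ≠ 0) (hc : c ≠ 0) (r b : ℝ) (n : ℤ) (hn : 0 ≤ n) :
    polySeq 1 q r 1 b c n ≠ 0 := by
  lift n to ℕ using hn
  intro h
  have := polySeqNonneg_degree hq hc r b n
  rw [show polySeqNonneg 1 q r 1 b c n = 0 from h] at this
  simp at this

end Recurrence

/-! ### Products over pairs a < k -/

section PairProducts

variable {R : Type*} [CommRing R]

theorem prod_pairs_const (N : ℕ) (x : R) :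
    ∏ k ∈ Finset.range N, ∏ _a ∈ Finset.range k, x = x ^ N.choose 2 := by
  simp only [Finset.prod_const, Finset.card_range]
  rw [Finset.prod_pow_eq_pow_sum, Finset.sum_range_id, Nat.choose_two_right]

theorem prod_pairs_succ (m : ℕ) (F : ℕ → ℕ → R) :
    ∏ k ∈ Finset.range (m + 1), ∏ a ∈ Finset.range k, F k a =
      ∏ j ∈ Finset.range m, ∏ a ∈ Finset.range (j + 1), F (j + 1) a := by
  rw [Finset.prod_range_succ' (fun k => ∏ a ∈ Finset.range k, F k a) m]
  simp

/-- Among pairs 0 ≤ a < k ≤ N the difference i + 1 occurs N - i times. -/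
theorem prod_pairs_sub (N : ℕ) (f : ℕ → R) :
    ∏ k ∈ Finset.range (N + 1), ∏ a ∈ Finset.range k, f (k - a) =
      ∏ i ∈ Finset.range (N + 1), f (i + 1) ^ (N - i) := by
  induction N with
  | zero => simp
  | succ N ih =>
    have h1 : ∏ a ∈ Finset.range (N + 1), f (N + 1 - a) = ∏ i ∈ Finset.range (N + 1), f (i + 1) := by
      rw [← Finset.prod_range_reflect]
      refine Finset.prod_congr rfl fun a ha => ?_
      have := Finset.mem_range.mp ha
      congr 1
      omega
    rw [Finset.prod_range_succ, ih, Finset.prod_range_succ _ (N + 1), h1, Nat.sub_self, pow_zero,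
      mul_one, ← Finset.prod_mul_distrib]
    refine Finset.prod_congr rfl fun i hi => ?_
    have := Finset.mem_range.mp hi
    rw [← pow_succ]
    congr 1
    omega

/-- There are C(N,2) pairs a < k < N, and the sum of a over them is C(N,3). -/
theorem prod_pairs_zpow {F : Type*} [Field F] {u : F} (hu : u ≠ 0) (A K : ℤ) (N : ℕ) :
    ∏ k ∈ Finset.range N, ∏ a ∈ Finset.range k, u ^ (A + K * a) =
      u ^ (A * (N.choose 2 : ℤ) + K * (N.choose 3 : ℤ)) := by
  have inner : ∀ k : ℕ, ∏ a ∈ Finset.range k, u ^ (A + K * a) =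
      u ^ (A * (k : ℤ) + K * (k.choose 2 : ℤ)) := by
    intro k
    induction k with
    | zero => simp
    | succ k ih =>
      rw [Finset.prod_range_succ, ih, ← zpow_add₀ hu, Nat.choose_succ_succ' k 1, Nat.choose_one_right]
      congr 1
      push_cast
      ring
  induction N with
  | zero => simp
  | succ N ih =>
    rw [Finset.prod_range_succ, ih, inner, ← zpow_add₀ hu, Nat.choose_succ_succ' N 1,
      Nat.choose_succ_succ' N 2, Nat.choose_one_right]
    congr 1
    push_cast
    ring

end PairProducts

/-! ### Evaluated brackets; powers, products and reciprocals -/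

section Brackets

variable {b c : ℝ} {U W : ℤ → ℝ[X]}

theorem prod_pairs_recurrence_sub (U : ℤ → ℝ[X]) (K : ℤ) (m : ℕ) :
    ∏ k ∈ Finset.range (m + 1), ∏ a ∈ Finset.range k, U (K * ((k : ℤ) - a)) =
      ∏ i ∈ Finset.range (m + 1), U (K * ((i : ℤ) + 1)) ^ (m - i) := by
  have := prod_pairs_sub m (fun t : ℕ => U (K * t))
  push_cast at this
  rw [← this]
  refine Finset.prod_congr rfl fun k _ => Finset.prod_congr rfl fun a ha => ?_
  rw [Nat.cast_sub (Finset.mem_range.mp ha).le]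

theorem prod_pairs_C_zpow (hc : c ≠ 0) (A K : ℤ) (N : ℕ) :
    ∏ k ∈ Finset.range N, ∏ a ∈ Finset.range k, (C ((-c) ^ (A + K * a)) : ℝ[X]) =
      C ((-c) ^ (A * (N.choose 2 : ℤ) + K * (N.choose 3 : ℤ))) := by
  rw [← prod_pairs_zpow (neg_ne_zero.mpr hc)]
  simp only [map_prod]

theorem prod_pairs_points (hc : c ≠ 0)
    (hU : ∀ n, U (n + 2) = (X + C b) * U (n + 1) + C c * U n) (hU0 : U 0 = 0) (hU1 : U 1 = 1)
    (hW : ∀ n, W (n + 2) = (X + C b) * W (n + 1) + C c * W n) (A K : ℤ) (m : ℕ) :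
    ∏ k ∈ Finset.range (m + 1), ∏ a ∈ Finset.range k,
      (W (A + K * a + 1) * W (A + K * k) - W (A + K * k + 1) * W (A + K * a)) =
    C ((-c) ^ (A * ((m + 1).choose 2 : ℤ) + K * ((m + 1).choose 3 : ℤ))) *
      (W 1 ^ 2 - W 0 * W 2) ^ (m + 1).choose 2 *
      ∏ i ∈ Finset.range (m + 1), U (K * ((i : ℤ) + 1)) ^ (m - i) := by
  rw [← prod_pairs_C_zpow hc, ← prod_pairs_const, ← prod_pairs_recurrence_sub]
  simp only [← Finset.prod_mul_distrib]
  refine Finset.prod_congr rfl fun k _ => Finset.prod_congr rfl fun a _ => ?_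
  rw [← recurrence_vajda hc hU hU0 hU1 hW, show A + K * a + K * ((k : ℤ) - a) = A + K * k by ring]
  ring

theorem prod_pairs_coeff (hc : c ≠ 0)
    (hU : ∀ n, U (n + 2) = (X + C b) * U (n + 1) + C c * U n) (hU0 : U 0 = 0) (hU1 : U 1 = 1)
    (K : ℤ) (m : ℕ) :
    ∏ k ∈ Finset.range (m + 1), ∏ a ∈ Finset.range k,
      (U (K * k) * (C c * U (K * a - 1)) - C c * U (K * k - 1) * U (K * a)) =
    C ((-c) ^ (K * ((m + 1).choose 3 : ℤ))) *
      ∏ i ∈ Finset.range (m + 1), U (K * ((i : ℤ) + 1)) ^ (m - i) := by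
  have h := prod_pairs_C_zpow hc 0 K (m + 1)
  rw [zero_mul, zero_add] at h
  rw [← h, ← prod_pairs_recurrence_sub]
  simp only [← Finset.prod_mul_distrib]
  refine Finset.prod_congr rfl fun k _ => Finset.prod_congr rfl fun a _ => ?_
  have h := recurrence_coeff_bracket hc hU hU0 hU1 (K * a) (K * k)
  rw [zero_add, show K * ((k : ℤ) - a) = K * k - K * a by ring]
  linear_combination -h

theorem det_recurrence_pow (hc : c ≠ 0)
    (hU : ∀ n, U (n + 2) = (X + C b) * U (n + 1) + C c * U n) (hU0 : U 0 = 0) (hU1 : U 1 = 1)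
    (hW : ∀ n, W (n + 2) = (X + C b) * W (n + 1) + C c * W n) (n m : ℕ) :
    Matrix.det (Matrix.of fun i j : Fin (m + 1) => W ((n : ℤ) + (i : ℕ) + (j : ℕ)) ^ m) =
      (-1) ^ ((n + 1) * (m + 1).choose 2) * (W 1 ^ 2 - W 0 * W 2) ^ (m + 1).choose 2 *
        C c ^ (n * (m + 1).choose 2 + 2 * (m + 1).choose 3) *
        ∏ i ∈ Finset.range (m + 1),
          ((m.choose i : ℝ[X]) * U ((i : ℤ) + 1) ^ (2 * (m - i))) := by
  have h := det_linear_form_pow m (fun a => W ((n : ℤ) + 1 * a + 1)) (fun a => W ((n : ℤ) + 1 * a))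
    (fun j => U (1 * j)) (fun j => C c * U (1 * j - 1))
  -- The forms' brackets appear here with the orientation opposite to `prod_pairs_coeff`; this sign
  -- turns n into n + 1 in the exponent of -1.
  have hsw : ∏ k ∈ Finset.range (m + 1), ∏ a ∈ Finset.range k,
      (U (1 * (a : ℤ)) * (C c * U (1 * (k : ℤ) - 1)) - U (1 * (k : ℤ)) * (C c * U (1 * (a : ℤ) - 1)))
      = (-1) ^ (m + 1).choose 2 * ∏ k ∈ Finset.range (m + 1), ∏ a ∈ Finset.range k,
      (U (1 * (k : ℤ)) * (C c * U (1 * (a : ℤ) - 1)) -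
        C c * U (1 * (k : ℤ) - 1) * U (1 * (a : ℤ))) := by
    rw [← prod_pairs_const]
    simp only [← Finset.prod_mul_distrib]
    refine Finset.prod_congr rfl fun k _ => Finset.prod_congr rfl fun a _ => ?_
    ring
  rw [hsw, prod_pairs_points hc hU hU0 hU1 hW, prod_pairs_coeff hc hU hU0 hU1] at h
  have e : ∀ i j : ℕ, U (1 * (j : ℤ)) * W ((n : ℤ) + 1 * i + 1) +
      C c * U (1 * (j : ℤ) - 1) * W ((n : ℤ) + 1 * i) = W ((n : ℤ) + i + j) := by
    intro i j
    rw [← recurrence_shift hc hU hU0 hU1 hW, one_mul, one_mul]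
  simp only [e] at h
  rw [h]
  simp only [one_mul, Finset.prod_mul_distrib, pow_mul', Finset.prod_pow]
  have z1 : (-c) ^ ((n : ℤ) * ((m + 1).choose 2 : ℤ) + ((m + 1).choose 3 : ℤ)) =
    (-c) ^ (n * (m + 1).choose 2 + (m + 1).choose 3) := by
    rw [← zpow_natCast]; push_cast; rfl
  rw [z1, zpow_natCast]
  -- Points and forms each contribute (-c)^C(m+1,3); the two signs cancel.
  have hT : ((-1 : ℝ[X]) ^ (m + 1).choose 3) * (-1) ^ (m + 1).choose 3 = 1 := by
    rw [← mul_pow]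
    simp
  generalize (m + 1).choose 2 = B at *
  generalize (m + 1).choose 3 = T at *
  generalize ∏ i ∈ Finset.range (m + 1), U ((i : ℤ) + 1) ^ (m - i) = V
  generalize ∏ i ∈ Finset.range (m + 1), (m.choose i : ℝ[X]) = M
  rw [C_pow, C_pow, C_neg, neg_pow (C c), neg_pow (C c), ← pow_mul, two_mul T,
    mul_comm B, add_one_mul]
  simp only [pow_add]
  linear_combination ((W 1 ^ 2 - W 0 * W 2) ^ B * (C c) ^ (n * B) * (C c) ^ T * (C c) ^ T *
    (-1) ^ (n * B) * (-1) ^ B * V ^ 2 * M) * hT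

theorem det_recurrence_prod (hc : c ≠ 0)
    (hU : ∀ n, U (n + 2) = (X + C b) * U (n + 1) + C c * U n) (hU0 : U 0 = 0) (hU1 : U 1 = 1)
    (hW : ∀ n, W (n + 2) = (X + C b) * W (n + 1) + C c * W n) (A : ℤ) (m : ℕ) (δ ε : ℕ → ℤ) :
    Matrix.det (Matrix.of fun i j : Fin (m + 1) =>
        (∏ f ∈ Finset.Ico (j : ℕ) m, W (A + (i : ℕ) + δ f)) *
          ∏ g ∈ Finset.range (j : ℕ), W (A + (i : ℕ) + ε g)) =
      (-(W 1 ^ 2 - W 0 * W 2)) ^ (m + 1).choose 2 *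
        C ((-c) ^ (A * ((m + 1).choose 2 : ℤ) + ((m + 1).choose 3 : ℤ))) *
        (∏ i ∈ Finset.range (m + 1), U ((i : ℤ) + 1) ^ (m - i)) *
        ∏ j ∈ Finset.range m, ∏ i ∈ Finset.range (j + 1),
          (C ((-c) ^ (δ j)) * U (ε i - δ j)) := by
  have h := det_prod_linear_forms m (fun a => W (A + 1 * a + 1)) (fun a => W (A + 1 * a))
    (fun f => U (δ f)) (fun f => C c * U (δ f - 1)) (fun g => U (ε g)) (fun g => C c * U (ε g - 1))
  rw [prod_pairs_points hc hU hU0 hU1 hW] at h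
  simp only [recurrence_coeff_bracket hc hU hU0 hU1, ← recurrence_shift hc hU hU0 hU1 hW,
    one_mul] at h
  have hs : ∏ j ∈ Finset.range m, ∏ i ∈ Finset.range (j + 1), -(C ((-c) ^ δ j) * U (ε i - δ j)) =
      (-1) ^ (m + 1).choose 2 * ∏ j ∈ Finset.range m, ∏ i ∈ Finset.range (j + 1),
        (C ((-c) ^ δ j) * U (ε i - δ j)) := by
    rw [← prod_pairs_const, prod_pairs_succ]
    simp only [← Finset.prod_mul_distrib, neg_one_mul]
  rw [h, hs, neg_pow (W 1 ^ 2 - W 0 * W 2)]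
  ring

theorem det_recurrence_inv (hc : c ≠ 0)
    (hU : ∀ n, U (n + 2) = (X + C b) * U (n + 1) + C c * U n) (hU0 : U 0 = 0) (hU1 : U 1 = 1)
    (hW : ∀ n, W (n + 2) = (X + C b) * W (n + 1) + C c * W n)
    {F : Type*} [Field F] (φ : ℝ[X] →+* F) (A K : ℤ) (m : ℕ)
    (hne : ∀ i j : Fin (m + 1), φ (W (A + K * (i : ℕ) + K * (j : ℕ))) ≠ 0) :
    Matrix.det (Matrix.of fun i j : Fin (m + 1) => 1 / φ (W (A + K * (i : ℕ) + K * (j : ℕ)))) =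
      φ (C ((-1) ^ (A * ((m + 1).choose 2 : ℤ))) *
          C (c ^ (A * ((m + 1).choose 2 : ℤ) + 2 * K * ((m + 1).choose 3 : ℤ))) *
          (W 1 ^ 2 - W 0 * W 2) ^ (m + 1).choose 2 *
          ∏ i ∈ Finset.range (m + 1), U (K * ((i : ℤ) + 1)) ^ (2 * (m - i))) /
        φ (∏ i : Fin (m + 1), ∏ j : Fin (m + 1), W (A + K * (i : ℕ) + K * (j : ℕ))) := by
  have e : ∀ i j : ℕ, U (K * (j : ℤ)) * W (A + K * i + 1) +
      C c * U (K * (j : ℤ) - 1) * W (A + K * i) = W (A + K * i + K * j) := by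
    intro i j
    rw [← recurrence_shift hc hU hU0 hU1 hW]
  have h := det_inv_linear_form φ m (fun a => W (A + K * a + 1)) (fun a => W (A + K * a))
    (fun j => U (K * j)) (fun j => C c * U (K * j - 1)) (by simpa only [e] using hne)
  rw [← prod_pairs_succ m (fun k a => U (K * (k : ℤ)) * (C c * U (K * (a : ℤ) - 1)) -
      C c * U (K * (k : ℤ) - 1) * U (K * (a : ℤ))), prod_pairs_points hc hU hU0 hU1 hW,
    prod_pairs_coeff hc hU hU0 hU1] at h
  simp only [e] at h
  rw [h]
  congr 2
  have hz : (-c) ^ (A * ((m + 1).choose 2 : ℤ) + K * ((m + 1).choose 3 : ℤ)) *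
      (-c) ^ (K * ((m + 1).choose 3 : ℤ)) = (-1) ^ (A * ((m + 1).choose 2 : ℤ)) *
      c ^ (A * ((m + 1).choose 2 : ℤ) + 2 * K * ((m + 1).choose 3 : ℤ)) := by
    rw [← zpow_add₀ (neg_ne_zero.mpr hc), neg_eq_neg_one_mul c, mul_zpow]
    congr 1
    · rw [add_assoc, zpow_add₀ (by norm_num), ← two_mul, zpow_mul (-1 : ℝ) 2]
      norm_num
    · congr 1
      ring
  rw [← C_mul, ← hz, C_mul]
  simp only [pow_mul', Finset.prod_pow]
  ring

end Brackets

/-! ### Rising powers -/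

section RisingPowers

variable {b c : ℝ} {U W : ℤ → ℝ[X]}

theorem risingPow_add_eq_prod_Ico (W : ℤ → ℝ[X]) (A : ℤ) (j m : ℕ) :
    risingPow W (A + j) m = ∏ t ∈ Finset.Ico j (j + m), W (A + t) := by
  rw [Finset.prod_Ico_eq_prod_range, Nat.add_sub_cancel_left, risingPow]
  simp only [Nat.cast_add, add_assoc]

/-- The windows [j, e), [e, m) and [m, m+j) tile [j, j+m). For e ≤ m a rising power is therefore a
product-type entry times a factor depending only on the row. -/
theorem prod_Ico_mul_prod_Ico_of_le {R : Type*} [CommMonoid R] (g : ℕ → R) {j e m : ℕ} (hj : j ≤ e)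
    (hem : e ≤ m) :
    (∏ t ∈ Finset.Ico e m, g t) * ((∏ t ∈ Finset.Ico j e, g t) * ∏ t ∈ Finset.range j, g (m + t)) =
      ∏ t ∈ Finset.Ico j (j + m), g t := by
  rw [← Finset.prod_Ico_consecutive g (hj.trans hem) (Nat.le_add_left m j),
    ← Finset.prod_Ico_consecutive g hj hem, Finset.prod_Ico_eq_prod_range g m (j + m),
    Nat.add_sub_cancel]
  simp only [mul_left_comm, mul_assoc]

/-- For m ≤ e the windows [j, e) and [m, m+j) together cover [j, j+m) with [m, e) in excess, so the
row factor moves to the rising-power side. -/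
theorem prod_Ico_mul_prod_Ico_of_ge {R : Type*} [CommMonoid R] (g : ℕ → R) {j e m : ℕ} (hj : j ≤ e)
    (hem : m ≤ e) :
    (∏ t ∈ Finset.Ico m e, g t) * ∏ t ∈ Finset.Ico j (j + m), g t =
      (∏ t ∈ Finset.Ico j e, g t) * ∏ t ∈ Finset.range j, g (m + t) := by
  have h : ∏ t ∈ Finset.range j, g (m + t) = ∏ t ∈ Finset.Ico m (j + m), g t := by
    rw [Finset.prod_Ico_eq_prod_range g m (j + m), Nat.add_sub_cancel]
  rw [h]
  rcases le_total j m with hjm | hjm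
  · rw [← Finset.prod_Ico_consecutive g hjm (Nat.le_add_left m j),
      ← Finset.prod_Ico_consecutive g hjm hem]
    simp only [mul_left_comm, mul_assoc]
  · rw [← Finset.prod_Ico_consecutive g hjm (Nat.le_add_right j m),
      ← Finset.prod_Ico_consecutive g hjm hj]
    simp only [mul_left_comm, mul_comm]

/-- The exponent is the sum of j(j+1) over j < e. -/
theorem prod_pairs_C_zpow_diag (hc : c ≠ 0) (e : ℕ) :
    ∏ j ∈ Finset.range e, ∏ _i ∈ Finset.range (j + 1), (C ((-c) ^ (j : ℤ)) : ℝ[X]) =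
      C ((-c) ^ (2 * ((e + 1).choose 3 : ℤ))) := by
  induction e with
  | zero => simp [Nat.choose_eq_zero_of_lt]
  | succ e ih =>
    have h3 : 2 * ((e + 1).choose 2 : ℤ) = e * (e + 1) := by
      have h4 := Nat.choose_succ_right_eq (e + 1) 1
      rw [Nat.choose_one_right, Nat.add_sub_cancel] at h4
      zify at h4
      linarith
    rw [Finset.prod_range_succ, ih, Finset.prod_const, Finset.card_range, ← C_pow, ← C_mul,
      ← zpow_natCast, ← zpow_mul, ← zpow_add₀ (neg_ne_zero.mpr hc), Nat.choose_succ_succ' (e + 1) 2]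
    congr 2
    push_cast
    linarith

/-- The determinant formula for products of forms, specialised to consecutive indices. -/
theorem det_recurrence_prod_consecutive (hc : c ≠ 0)
    (hU : ∀ n, U (n + 2) = (X + C b) * U (n + 1) + C c * U n) (hU0 : U 0 = 0) (hU1 : U 1 = 1)
    (hW : ∀ n, W (n + 2) = (X + C b) * W (n + 1) + C c * W n) (A : ℤ) (m e : ℕ) :
    Matrix.det (Matrix.of fun i j : Fin (e + 1) =>
        (∏ f ∈ Finset.Ico (j : ℕ) e, W (A + (i : ℕ) + (f : ℕ))) *
          ∏ g ∈ Finset.range (j : ℕ), W (A + (i : ℕ) + ((m + g : ℕ) : ℤ))) =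
      (-(W 1 ^ 2 - W 0 * W 2)) ^ (e + 1).choose 2 *
        C ((-c) ^ (A * ((e + 1).choose 2 : ℤ) + 3 * ((e + 1).choose 3 : ℤ))) *
        ∏ i ∈ Finset.range e, (U ((i : ℤ) + 1) * U ((m : ℤ) - i)) ^ (e - i) := by
  rw [det_recurrence_prod hc hU hU0 hU1 hW A e (fun f => (f : ℤ)) (fun g => ((m + g : ℕ) : ℤ))]
  have h1 : ∏ j ∈ Finset.range e, ∏ i ∈ Finset.range (j + 1), U (((m + i : ℕ) : ℤ) - j) =
      ∏ i ∈ Finset.range e, U ((m : ℤ) - i) ^ (e - i) := by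
    -- The pair (k, a) = (j+1, i) gives m + 1 - (k - a) = m + i - j.
    have h := prod_pairs_sub e (fun t : ℕ => U ((m : ℤ) + 1 - t))
    rw [prod_pairs_succ e (fun k a => U ((m : ℤ) + 1 - ((k - a : ℕ) : ℤ))),
      Finset.prod_range_succ _ e, Nat.sub_self, pow_zero, mul_one] at h
    push_cast [add_sub_add_right_eq_sub] at h ⊢
    rw [← h]
    refine Finset.prod_congr rfl fun j _ => Finset.prod_congr rfl fun i hi => ?_
    rw [Nat.cast_sub (Finset.mem_range.mp hi).le]
    congr 1
    push_cast
    ring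
  simp only [Finset.prod_mul_distrib, h1, prod_pairs_C_zpow_diag hc, mul_pow, Finset.prod_range_succ _ e, Nat.sub_self,
    pow_zero, mul_one]
  rw [show A * ((e + 1).choose 2 : ℤ) + 3 * ((e + 1).choose 3 : ℤ) =
    A * ((e + 1).choose 2 : ℤ) + ((e + 1).choose 3 : ℤ) + 2 * ((e + 1).choose 3 : ℤ) by ring,
    zpow_add₀ (neg_ne_zero.mpr hc) (_ + _), C_mul]
  ring

/-- The product-type determinant contains U(m - i) at i = m, hence is 0; it differs from the
rising-power determinant by nonzero row factors. -/
theorem det_risingPow_eq_zero (hc : c ≠ 0)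
    (hU : ∀ n, U (n + 2) = (X + C b) * U (n + 1) + C c * U n) (hU0 : U 0 = 0) (hU1 : U 1 = 1)
    (hW : ∀ n, W (n + 2) = (X + C b) * W (n + 1) + C c * W n) (A : ℤ)
    (hne : ∀ t : ℕ, W (A + t) ≠ 0) {m e : ℕ} (hme : m < e) :
    Matrix.det (Matrix.of fun i j : Fin (e + 1) =>
        risingPow W (A + (i : ℕ) + (j : ℕ)) m) = 0 := by
  have h := det_recurrence_prod_consecutive hc hU hU0 hU1 hW A m e
  have h0 : ∏ i ∈ Finset.range e, (U ((i : ℤ) + 1) * U ((m : ℤ) - i)) ^ (e - i) = 0 := by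
    refine Finset.prod_eq_zero (Finset.mem_range.mpr hme) ?_
    rw [sub_self, hU0, mul_zero, zero_pow (Nat.sub_ne_zero_of_lt hme)]
  rw [h0, mul_zero] at h
  have h' : (Matrix.of fun i j : Fin (e + 1) =>
        (∏ f ∈ Finset.Ico (j : ℕ) e, W (A + (i : ℕ) + (f : ℕ))) *
          ∏ g ∈ Finset.range (j : ℕ), W (A + (i : ℕ) + ((m + g : ℕ) : ℤ))) =
      Matrix.of fun i j : Fin (e + 1) => (∏ t ∈ Finset.Ico m e, W (A + (i : ℕ) + (t : ℕ))) *
        risingPow W (A + (i : ℕ) + (j : ℕ)) m := by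
    ext1 i j
    rw [Matrix.of_apply, Matrix.of_apply, risingPow_add_eq_prod_Ico,
      prod_Ico_mul_prod_Ico_of_ge (fun t : ℕ => W (A + (i : ℕ) + (t : ℤ)))
        (Nat.lt_succ_iff.mp j.2) hme.le]
  rw [h'] at h
  have h'' := Matrix.det_mul_column
    (fun i : Fin (e + 1) => ∏ t ∈ Finset.Ico m e, W (A + (i : ℕ) + (t : ℕ)))
    (Matrix.of fun i j : Fin (e + 1) => risingPow W (A + (i : ℕ) + (j : ℕ)) m)
  simp only [Matrix.of_apply] at h''
  rw [h''] at h
  refine (mul_eq_zero.mp h).resolve_left ?_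
  refine Finset.prod_ne_zero_iff.mpr fun i _ => Finset.prod_ne_zero_iff.mpr fun t _ => ?_
  have := hne (i + t)
  push_cast [← add_assoc] at this
  exact this

theorem det_risingPow_of_le (hc : c ≠ 0)
    (hU : ∀ n, U (n + 2) = (X + C b) * U (n + 1) + C c * U n) (hU0 : U 0 = 0) (hU1 : U 1 = 1)
    (hW : ∀ n, W (n + 2) = (X + C b) * W (n + 1) + C c * W n) (A : ℤ) {m e : ℕ} (hem : e ≤ m) :
    Matrix.det (Matrix.of fun i j : Fin (e + 1) => risingPow W (A + (i : ℕ) + (j : ℕ)) m) =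
      (-(W 1 ^ 2 - W 0 * W 2)) ^ (e + 1).choose 2 *
        C ((-c) ^ (A * ((e + 1).choose 2 : ℤ) + 3 * ((e + 1).choose 3 : ℤ))) *
        (∏ i ∈ Finset.range e, (U ((i : ℤ) + 1) * U ((m : ℤ) - i)) ^ (e - i)) *
        ∏ i ∈ Finset.Icc e (2 * e), risingPow W (A + i) (m - e) := by
  have h' : (Matrix.of fun i j : Fin (e + 1) => risingPow W (A + (i : ℕ) + (j : ℕ)) m) =
      Matrix.of fun i j : Fin (e + 1) => risingPow W (A + (i : ℕ) + (e : ℕ)) (m - e) *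
        (Matrix.of fun i j : Fin (e + 1) =>
        (∏ f ∈ Finset.Ico (j : ℕ) e, W (A + (i : ℕ) + (f : ℕ))) *
          ∏ g ∈ Finset.range (j : ℕ), W (A + (i : ℕ) + ((m + g : ℕ) : ℤ))) i j := by
    ext1 i j
    rw [Matrix.of_apply, Matrix.of_apply, Matrix.of_apply, risingPow_add_eq_prod_Ico,
      risingPow_add_eq_prod_Ico, Nat.add_sub_cancel' hem,
      prod_Ico_mul_prod_Ico_of_le (fun t : ℕ => W (A + (i : ℕ) + (t : ℤ)))
        (Nat.lt_succ_iff.mp j.2) hem]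
  have h2 : ∏ i ∈ Finset.Icc e (2 * e), risingPow W (A + i) (m - e) =
      ∏ i : Fin (e + 1), risingPow W (A + (i : ℕ) + (e : ℕ)) (m - e) := by
    rw [← Finset.prod_range (fun i : ℕ => risingPow W (A + (i : ℕ) + (e : ℕ)) (m - e)),
      ← Finset.Ico_add_one_right_eq_Icc, Finset.prod_Ico_eq_prod_range,
      show 2 * e + 1 - e = e + 1 by omega]
    refine Finset.prod_congr rfl fun i _ => ?_
    push_cast
    congr 1
    ring
  rw [h', Matrix.det_mul_column, det_recurrence_prod_consecutive hc hU hU0 hU1 hW, h2, mul_comm]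

end RisingPowers

/-! ### Assembling the four formulas -/

theorem three_mul_choose_three (e : ℕ) :
    3 * ((e + 1).choose 3 : ℤ) = ((e : ℤ) - 1) * ((e + 1).choose 2 : ℤ) := by
  have h := Nat.choose_succ_right_eq (e + 1) 2
  rcases e with _ | e
  · simp [Nat.choose_eq_zero_of_lt]
  · rw [show e + 1 + 1 - 2 = e by omega] at h
    zify at h
    push_cast
    linarith

theorem corollary6 (q r b c : ℝ) (hq : q ≠ 0) (hc : c ≠ 0)
    (P U : ℤ → ℝ[X])
    (hP : P = polySeq 1 q r 1 b c)
    (hU : U = polySeq 0 0 1 1 b c)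
    (Δ : ℝ[X])
    (hΔ : Δ = C (q ^ 2 - q) * X ^ 2 + C (2 * q * r - r - b * q) * X + C (r ^ 2 - b * r - c))
    (n m d : ℕ) (hm : 1 ≤ m) (hd : 1 ≤ d) (s k : ℤ) (δ ε : ℕ → ℤ) :
    -- powers
    (Matrix.det (Matrix.of fun i j : Fin (m + 1) => P ((n : ℤ) + (i : ℕ) + (j : ℕ)) ^ m) =
      (-1) ^ ((n + 1) * (m + 1).choose 2) * Δ ^ (m + 1).choose 2 *
        C c ^ (n * (m + 1).choose 2 + 2 * (m + 1).choose 3) *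
        ∏ i ∈ Finset.range (m + 1),
          ((m.choose i : ℝ[X]) * U ((i : ℤ) + 1) ^ (2 * (m - i)))) ∧
    -- products
    (Matrix.det (Matrix.of fun i j : Fin (m + 1) =>
        (∏ f ∈ Finset.Icc ((j : ℕ) + 1) m, P ((n : ℤ) + (i : ℕ) + δ f)) *
          ∏ g ∈ Finset.Icc 1 (j : ℕ), P ((n : ℤ) + (i : ℕ) + ε g)) =
      (-Δ) ^ (m + 1).choose 2 *
        (-C c) ^ (n * (m + 1).choose 2 + (m + 1).choose 3) *
        (∏ l ∈ Finset.Icc 1 m, U (l : ℤ) ^ (m + 1 - l)) *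
        ∏ j ∈ Finset.Icc 1 m, ∏ i ∈ Finset.Icc 1 j,
          (C ((-c) ^ (δ j)) * U (ε i - δ j))) ∧
    -- reciprocals, as an identity of rational functions
    ((∀ i j : Fin (m + 1), s + k * ((n : ℤ) + (i : ℕ) + (j : ℕ)) < 0 →
        P (s + k * ((n : ℤ) + (i : ℕ) + (j : ℕ))) ≠ 0) →
      Matrix.det (Matrix.of fun i j : Fin (m + 1) =>
        1 / algebraMap ℝ[X] (RatFunc ℝ) (P (s + k * ((n : ℤ) + (i : ℕ) + (j : ℕ))))) =
      algebraMap ℝ[X] (RatFunc ℝ)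
          (C ((-1) ^ ((s + k * n) * ((m + 1).choose 2 : ℤ))) *
            C (c ^ ((s + k * n) * ((m + 1).choose 2 : ℤ) + 2 * k * ((m + 1).choose 3 : ℤ))) *
            Δ ^ (m + 1).choose 2 *
            ∏ i ∈ Finset.range (m + 1), U (k * ((i : ℤ) + 1)) ^ (2 * (m - i))) /
        algebraMap ℝ[X] (RatFunc ℝ)
          (∏ i : Fin (m + 1), ∏ j : Fin (m + 1),
            P (s + k * ((n : ℤ) + (i : ℕ) + (j : ℕ))))) ∧
    -- rising powers
    (Matrix.det (Matrix.of fun i j : Fin d =>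
        risingPow P ((n : ℤ) + (i : ℕ) + (j : ℕ)) m) =
      (-1) ^ (n * d.choose 2 + (d + 1).choose 3) *
        C (c ^ (((n : ℤ) + d - 2) * (d.choose 2 : ℤ))) * Δ ^ d.choose 2 *
        (∏ i ∈ Finset.Icc 1 (d - 1), (U (i : ℤ) * U ((m : ℤ) + 1 - i)) ^ (d - i)) *
        ∏ i ∈ Finset.Icc (d - 1) (2 * (d - 1)), risingPow P ((n : ℤ) + i) (m + 1 - d)) := by
  have hU' : ∀ n, U (n + 2) = (X + C b) * U (n + 1) + C c * U n := fun n => by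
    rw [hU, polySeq_add_two _ _ _ _ _ _ hc, C_1, one_mul]
  have hP' : ∀ n, P (n + 2) = (X + C b) * P (n + 1) + C c * P n := fun n => by
    rw [hP, polySeq_add_two _ _ _ _ _ _ hc, C_1, one_mul]
  have hU0 : U 0 = 0 := by rw [hU, polySeq_zero, C_0]
  have hU1 : U 1 = 1 := by rw [hU, polySeq_one, C_0, C_1, zero_mul, zero_add]
  have hP0 : P 0 = 1 := by rw [hP, polySeq_zero, C_1]
  have hP1 : P 1 = C q * X + C r := by rw [hP, polySeq_one]
  -- The Δ of the statement is the Cassini invariant of P.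
  have hD : P 1 ^ 2 - P 0 * P 2 = Δ := by
    have h2 := hP' 0
    rw [zero_add, zero_add, hP0, hP1] at h2
    rw [h2, hP0, hP1, hΔ]
    simp only [C_sub, C_mul, C_pow, map_ofNat]
    ring
  have hPne : ∀ n : ℤ, 0 ≤ n → P n ≠ 0 := fun n hn => by
    rw [hP]
    exact polySeq_ne_zero hq hc r b n hn
  refine ⟨?_, ?_, ?_, ?_⟩
  · rw [det_recurrence_pow hc hU' hU0 hU1 hP', hD]
  · have h := det_recurrence_prod hc hU' hU0 hU1 hP' n m (fun f => δ (f + 1)) (fun g => ε (g + 1))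
    have hIcc : ∀ (a k : ℕ) (f : ℕ → ℝ[X]),
        ∏ i ∈ Finset.Icc (a + 1) k, f i = ∏ i ∈ Finset.Ico a k, f (i + 1) := fun a k f => by
      rw [Finset.prod_Ico_add' f a k 1, Finset.Ico_add_one_right_eq_Icc]
    simp only [hIcc, ← Finset.range_eq_Ico]
    rw [h, hD, Finset.prod_range_succ _ m, Nat.sub_self, pow_zero, mul_one]
    have hz : (C ((-c) ^ ((n : ℤ) * ((m + 1).choose 2 : ℤ) + ((m + 1).choose 3 : ℤ))) : ℝ[X]) =
        (-C c) ^ (n * (m + 1).choose 2 + (m + 1).choose 3) := by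
      rw [← C_neg, ← C_pow, ← zpow_natCast]
      push_cast
      rfl
    rw [hz]
    simp only [Nat.add_sub_add_right, Nat.cast_add, Nat.cast_one]
  · intro hne
    have e : ∀ i j : ℕ, s + k * ((n : ℤ) + i + j) = s + k * n + k * i + k * j := fun i j => by ring
    have h := det_recurrence_inv hc hU' hU0 hU1 hP' (algebraMap ℝ[X] (RatFunc ℝ)) (s + k * n) k m
      fun i j => by
        rw [Ne, FaithfulSMul.algebraMap_eq_zero_iff, ← e]
        rcases lt_or_ge (s + k * ((n : ℤ) + (i : ℕ) + (j : ℕ))) 0 with h | h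
        · exact hne i j h
        · exact hPne _ h
    rw [hD] at h
    simp only [e]
    exact h
  · obtain ⟨e, rfl⟩ : ∃ e, d = e + 1 := ⟨d - 1, by omega⟩
    rw [Nat.add_sub_cancel, Nat.add_sub_add_right]
    have hIcc : ∏ i ∈ Finset.Icc 1 e, (U (i : ℤ) * U ((m : ℤ) + 1 - i)) ^ (e + 1 - i) =
        ∏ i ∈ Finset.range e, (U ((i : ℤ) + 1) * U ((m : ℤ) - i)) ^ (e - i) := by
      rw [← Finset.Ico_add_one_right_eq_Icc, Finset.range_eq_Ico,
        ← Finset.prod_Ico_add' _ 0 e 1]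
      simp only [Nat.add_sub_add_right, Nat.cast_add, Nat.cast_one, add_sub_add_right_eq_sub]
    rw [hIcc]
    -- With d = e + 1 this separates d ≤ m + 1 from d > m + 1, where both sides vanish.
    rcases le_or_gt e m with hem | hem
    · rw [det_risingPow_of_le hc hU' hU0 hU1 hP' n hem, hD]
      congr 2
      have hexp : (n : ℤ) * ((e + 1).choose 2 : ℤ) + 3 * ((e + 1).choose 3 : ℤ) =
          ((n : ℤ) + (e + 1 : ℕ) - 2) * ((e + 1).choose 2 : ℤ) := by
        rw [three_mul_choose_three]
        push_cast
        ring
      have hsign : (-1 : ℝ) ^ (e + 1).choose 2 *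
          (-1) ^ ((n : ℤ) * ((e + 1).choose 2 : ℤ) + 3 * ((e + 1).choose 3 : ℤ)) =
          (-1) ^ (n * (e + 1).choose 2 + (e + 1 + 1).choose 3) := by
        rw [Nat.choose_succ_succ' (e + 1) 2, ← zpow_natCast, ← zpow_natCast,
          ← zpow_add₀ (by norm_num)]
        push_cast
        rw [show ((e + 1).choose 2 : ℤ) + ((n : ℤ) * ((e + 1).choose 2 : ℤ) +
          3 * ((e + 1).choose 3 : ℤ)) = (n * ((e + 1).choose 2 : ℤ) + (((e + 1).choose 2 : ℤ) +
          ((e + 1).choose 3 : ℤ))) + 2 * ((e + 1).choose 3 : ℤ) by ring,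
          zpow_add₀ (by norm_num), zpow_mul (-1 : ℝ) 2]
        norm_num
      have hC := congrArg (C : ℝ → ℝ[X]) hsign
      rw [C_mul, C_pow, C_pow, C_neg, C_1] at hC
      rw [neg_eq_neg_one_mul c, mul_zpow, C_mul, neg_pow Δ, ← hC, ← hexp]
      ring
    · rw [det_risingPow_eq_zero hc hU' hU0 hU1 hP' n (fun t => hPne _ (by positivity)) hem,
        Finset.prod_eq_zero (i := m) (Finset.mem_range.mpr hem)]
      · simp
      · rw [sub_self, hU0, mul_zero, zero_pow (Nat.sub_ne_zero_of_lt hem)]
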